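/- Let $k$ be a field and let $H\subseteq\mathbb{N}$ be a numerical semigroup (a submonoid of $\mathbb N$ with finite complement) with multiplicity $a=\min(H\setminus\{0\})$ and embedding dimension $n\ge 3$, where the embedding dimension is the number of elements of the minimal system of generators of $H$. Put $\ell=a-n+1$ and assume $\ell\ge 2$. Let $k[H]=k[t^s : s\in H]\subseteq k[t]$ be the semigroup ring, $\mathfrak m=(t^s : 0\ne s\in H)$ its graded maximal ideal, and $\mathrm{gr}(k[H])=\bigoplus_{i\ge 0}\mathfrak m^i/\mathfrak m^{i+1}$ its tangent cone. Let $$\mathrm{PF}(H)=\{x\in\mathbb Z\setminus H : x+s\in H \text{ for all } 0\ne s\in H\}.$$ Assume that $k[H]/(t^a)$ is stretched, i.e. that it is an Artinian local ring the square of whose maximal ideal is zero or principal. Assume also that $$\mathrm{PF}(H)=\{h+\alpha,\,h+2\alpha,\,\dots,\,h+(n-1)\alpha\}$$ for integers $h\ge 0$ and $\alpha>0$. Assume finally that we are in the case $j=n-1$: the minimal system of generators of $H$ is $$\{a,\,b\}\cup\{h+i\alpha+a : 1\le i\le n-2\},\qquad b=\frac{h+(n-1)\alpha+a}{\ell}.$$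 Put $h_1=h/a$. Then: 1. $\mathrm{gr}(k[H])$ is Cohen–Macaulay if and only if $\dfrac{h_1+1+\alpha}{\ell}\ge \ell$. 2. If $h_1\ge \ell^2-\ell-\alpha$, then $\mathrm{gr}(k[H])$ is Cohen–Macaulay. 3. If $\ell=2$, then $\mathrm{gr}(k[H])$ is Cohen–Macaulay. -/

import Mathlib

open Polynomial DirectSum

/-! ### The associated graded ring of an ideal -/

/-- The component `I ^ n / I ^ (n + 1)` of degree `n` of the associated graded ring of `I`. -/
def GrPiece {R : Type*} [CommRing R] (I : Ideal R) (n : ℕ) : Type _ :=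
  ↥(I ^ n) ⧸ Submodule.comap (I ^ n).subtype (I ^ (n + 1))

namespace GrPiece

variable {R : Type*} [CommRing R] (I : Ideal R)

instance addCommGroup (n : ℕ) : AddCommGroup (GrPiece I n) :=
  inferInstanceAs (AddCommGroup (↥(I ^ n) ⧸ Submodule.comap (I ^ n).subtype (I ^ (n + 1))))

instance module (n : ℕ) : Module R (GrPiece I n) :=
  inferInstanceAs (Module R (↥(I ^ n) ⧸ Submodule.comap (I ^ n).subtype (I ^ (n + 1))))

/-- The class of an element of `I ^ n` in `I ^ n / I ^ (n + 1)`. -/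
def cls (n : ℕ) : ↥(I ^ n) →ₗ[R] GrPiece I n :=
  Submodule.mkQ (Submodule.comap (I ^ n).subtype (I ^ (n + 1)))

theorem cls_surjective (n : ℕ) : Function.Surjective (cls I n) :=
  Submodule.mkQ_surjective _

theorem cls_eq_iff {n : ℕ} (x y : ↥(I ^ n)) :
    cls I n x = cls I n y ↔ (x : R) - y ∈ I ^ (n + 1) := by
  exact Submodule.Quotient.eq (Submodule.comap (I ^ n).subtype (I ^ (n + 1)))

/-- The product `I ^ i × I ^ j → I ^ (i + j)`. -/
def mulElt {i j : ℕ} (x : ↥(I ^ i)) (y : ↥(I ^ j)) : ↥(I ^ (i + j)) :=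
  ⟨(x : R) * y, by rw [pow_add]; exact Ideal.mul_mem_mul x.2 y.2⟩

theorem cls_mulElt_congr {i j : ℕ} {x x' : ↥(I ^ i)} {y y' : ↥(I ^ j)}
    (hx : cls I i x = cls I i x') (hy : cls I j y = cls I j y') :
    cls I (i + j) (mulElt I x y) = cls I (i + j) (mulElt I x' y') := by
  rw [cls_eq_iff] at *
  have h1 : ((x : R) - x') * y ∈ I ^ (i + j + 1) := by
    rw [show i + j + 1 = (i + 1) + j by ring, pow_add]
    exact Ideal.mul_mem_mul hx y.2
  have h2 : (x' : R) * ((y : R) - y') ∈ I ^ (i + j + 1) := by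
    rw [show i + j + 1 = i + (j + 1) by ring, pow_add]
    exact Ideal.mul_mem_mul x'.2 hy
  have h3 := add_mem h1 h2
  have h4 : ((x : R) - x') * y + (x' : R) * ((y : R) - y') = (x : R) * y - x' * y' := by ring
  rw [h4] at h3
  exact h3

/-- The multiplication `I ^ i / I ^ (i + 1) × I ^ j / I ^ (j + 1) → I ^ (i + j) / I ^ (i + j + 1)`
induced by the multiplication of `R`. -/
def mul {i j : ℕ} : GrPiece I i → GrPiece I j → GrPiece I (i + j) :=
  Quotient.lift₂ (fun x y => cls I (i + j) (mulElt I x y)) fun _ _ _ _ hx hy =>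
    cls_mulElt_congr I (Quotient.sound hx) (Quotient.sound hy)

theorem mul_cls {i j : ℕ} (x : ↥(I ^ i)) (y : ↥(I ^ j)) :
    mul I (cls I i x) (cls I j y) = cls I (i + j) (mulElt I x y) := rfl

/-- The class of `r` in `I ^ 0 / I ^ 1 = R / I`. -/
def scalar (r : R) : GrPiece I 0 := cls I 0 ⟨r, by simp⟩

theorem scalar_zero : scalar I 0 = 0 := (cls I 0).map_zero

theorem scalar_add (r s : R) : scalar I (r + s) = scalar I r + scalar I s :=
  (cls I 0).map_add ⟨r, by simp⟩ ⟨s, by simp⟩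

theorem scalar_neg (r : R) : scalar I (-r) = -scalar I r :=
  (cls I 0).map_neg ⟨r, by simp⟩

instance gMul : GradedMonoid.GMul (GrPiece I) := ⟨mul I⟩

instance gOne : GradedMonoid.GOne (GrPiece I) := ⟨scalar I 1⟩

theorem sigma_ext {i j : ℕ} (x : ↥(I ^ i)) (y : ↥(I ^ j)) (hij : i = j) (hxy : (x : R) = y) :
    (GradedMonoid.mk i (cls I i x) : GradedMonoid (GrPiece I)) =
      GradedMonoid.mk j (cls I j y) := by
  subst hij
  rw [Subtype.ext hxy]

instance gCommRing : DirectSum.GCommRing (GrPiece I) where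
  __ := gMul I
  __ := gOne I
  mul_zero := by
    intro i j a
    obtain ⟨x, rfl⟩ := cls_surjective I i a
    exact (cls_eq_iff I (mulElt I x 0) 0).2 (by simp [mulElt])
  zero_mul := by
    intro i j b
    obtain ⟨y, rfl⟩ := cls_surjective I j b
    exact (cls_eq_iff I (mulElt I 0 y) 0).2 (by simp [mulElt])
  mul_add := by
    intro i j a b c
    obtain ⟨x, rfl⟩ := cls_surjective I i a
    obtain ⟨y, rfl⟩ := cls_surjective I j b
    obtain ⟨z, rfl⟩ := cls_surjective I j c
    exact (cls_eq_iff I (mulElt I x (y + z)) (mulElt I x y + mulElt I x z)).2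
      (by simp [mulElt, _root_.mul_add])
  add_mul := by
    intro i j a b c
    obtain ⟨x, rfl⟩ := cls_surjective I i a
    obtain ⟨y, rfl⟩ := cls_surjective I i b
    obtain ⟨z, rfl⟩ := cls_surjective I j c
    exact (cls_eq_iff I (mulElt I (x + y) z) (mulElt I x z + mulElt I y z)).2
      (by simp [mulElt, _root_.add_mul])
  one_mul := by
    rintro ⟨i, a⟩
    obtain ⟨x, rfl⟩ := cls_surjective I i a
    exact sigma_ext I (mulElt I ⟨1, by simp⟩ x) x (zero_add i) (by simp [mulElt])
  mul_one := by
    rintro ⟨i, a⟩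
    obtain ⟨x, rfl⟩ := cls_surjective I i a
    exact sigma_ext I (mulElt I x ⟨1, by simp⟩) x (add_zero i) (by simp [mulElt])
  mul_assoc := by
    rintro ⟨i, a⟩ ⟨j, b⟩ ⟨l, c⟩
    obtain ⟨x, rfl⟩ := cls_surjective I i a
    obtain ⟨y, rfl⟩ := cls_surjective I j b
    obtain ⟨z, rfl⟩ := cls_surjective I l c
    exact sigma_ext I (mulElt I (mulElt I x y) z) (mulElt I x (mulElt I y z)) (add_assoc i j l)
      (by simp [mulElt, _root_.mul_assoc])
  mul_comm := by
    rintro ⟨i, a⟩ ⟨j, b⟩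
    obtain ⟨x, rfl⟩ := cls_surjective I i a
    obtain ⟨y, rfl⟩ := cls_surjective I j b
    exact sigma_ext I (mulElt I x y) (mulElt I y x) (add_comm i j)
      (by simp [mulElt, _root_.mul_comm])
  natCast m := scalar I m
  natCast_zero := by simpa using scalar_zero I
  natCast_succ m := by
    have := scalar_add I m 1
    rw [← Nat.cast_succ] at this
    exact this
  intCast m := scalar I m
  intCast_ofNat m := by simp
  intCast_negSucc_ofNat m := by rw [← scalar_neg]; simp

end GrPiece

/-- The associated graded ring `⨁ n, I ^ n / I ^ (n + 1)`, a commutative ring. -/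
abbrev AssociatedGradedRing {R : Type*} [CommRing R] (I : Ideal R) : Type _ :=
  ⨁ n : ℕ, GrPiece I n

/-! ### Cohen-Macaulay rings -/

/-- A Noetherian local ring is Cohen-Macaulay if its depth equals its Krull dimension, that is, if
its maximal ideal contains a regular sequence whose length is the Krull dimension. -/
structure IsCohenMacaulayLocal (R : Type*) [CommRing R] [IsLocalRing R] : Prop where
  noetherian : IsNoetherianRing R
  exists_regular : ∃ rs : List R, (∀ r ∈ rs, r ∈ IsLocalRing.maximalIdeal R) ∧
    RingTheory.Sequence.IsRegular R rs ∧ ringKrullDim R = (rs.length : WithBot ℕ∞)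

/-- A Noetherian ring is Cohen-Macaulay if all its localizations at prime ideals are. -/
structure IsCohenMacaulay (R : Type*) [CommRing R] : Prop where
  noetherian : IsNoetherianRing R
  localization : ∀ (p : Ideal R) [p.IsPrime], IsCohenMacaulayLocal (Localization.AtPrime p)

/-! ### Stretched rings -/

/-- An Artinian local ring is stretched if the square of its maximal ideal is zero or principal. -/
structure IsStretchedArtinianLocal (A : Type*) [CommRing A] : Prop where
  artinian : IsArtinianRing A
  isLocal : IsLocalRing A
  sq_maximalIdeal : IsLocalRing.maximalIdeal A ^ 2 = ⊥ ∨
    (IsLocalRing.maximalIdeal A ^ 2).IsPrincipal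

/-! ### Numerical semigroups and their semigroup rings -/

namespace NumSemigroup

/-- A numerical semigroup is a submonoid of `ℕ` with finite complement. -/
def IsNumerical (H : AddSubmonoid ℕ) : Prop := ((H : Set ℕ)ᶜ).Finite

/-- `a` is the multiplicity of `H`, the least nonzero element. -/
def IsMultiplicity (H : AddSubmonoid ℕ) (a : ℕ) : Prop := IsLeast {x : ℕ | x ∈ H ∧ x ≠ 0} a

/-- `A` is the minimal system of generators of `H`. -/
def IsMinimalGenerators (H : AddSubmonoid ℕ) (A : Set ℕ) : Prop :=
  Minimal (fun B : Set ℕ => AddSubmonoid.closure B = H) A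

/-- The set of pseudo-Frobenius numbers: the integers outside `H` all of whose translates by
nonzero elements of `H` lie in `H`. -/
def pseudoFrobenius (H : AddSubmonoid ℕ) : Set ℤ :=
  {x | (¬ ∃ m ∈ H, (m : ℤ) = x) ∧ ∀ s ∈ H, s ≠ 0 → ∃ m ∈ H, (m : ℤ) = x + s}

/-- The semigroup ring `k[H]`, the subalgebra of `k[t]` generated by all `t ^ s` with `s ∈ H`. -/
noncomputable def semigroupRing (k : Type*) [Field k] (H : AddSubmonoid ℕ) : Subalgebra k k[X] :=
  Algebra.adjoin k {f : k[X] | ∃ s ∈ H, f = X ^ s}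

/-- The element `t ^ s` of `k[H]`. -/
noncomputable def tpow (k : Type*) [Field k] {H : AddSubmonoid ℕ} (s : H) : semigroupRing k H :=
  ⟨X ^ (s : ℕ), Algebra.subset_adjoin ⟨s, s.2, rfl⟩⟩

/-- The graded maximal ideal of `k[H]`, generated by the `t ^ s` with `0 ≠ s ∈ H`. -/
noncomputable def gradedMaximalIdeal (k : Type*) [Field k] (H : AddSubmonoid ℕ) :
    Ideal (semigroupRing k H) :=
  Ideal.span {f | ∃ s : H, (s : ℕ) ≠ 0 ∧ f = tpow k s}

/-- The tangent cone `gr(k[H])`, the associated graded ring of the graded maximal ideal. -/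
abbrev TangentCone (k : Type*) [Field k] (H : AddSubmonoid ℕ) : Type _ :=
  AssociatedGradedRing (gradedMaximalIdeal k H)

end NumSemigroup

/-! Write N = n - 1 and c_i = h + iα + a, so that c_N = ℓb. Since the generators are minimal and the
h + iα are gaps, the a = ℓ + N integers 0, b, …, ℓb, c_1, …, c_{N-1} form the Apéry set of H with
respect to a (`apery`): every element of H is uniquely one of them plus a multiple of a. Modulo a
they split ℤ/a into two arithmetic progressions, which forces h ≡ 0 and b ≡ -α
(`eq_neg_of_partition_progressions`). Hence b + α = qa, and ℓb = c_N gives ℓq = h₁ + 1 + α. The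
quotient in the theorem is therefore the integer q, and the claim becomes: Cohen–Macaulay if and
only if q ≥ ℓ.

What decides is whether adding a always raises the 𝔪-adic order by exactly one, that is, whether the
form of t^a is a nonzerodivisor on the tangent cone (`isCohenMacaulay_tangentCone`,
`not_isCohenMacaulay_tangentCone`). If q < ℓ, the relation c_{N-1} + qa = (ℓ + 1)b has more
generators on the right than on the left, so somewhere along c_{N-1}, c_{N-1} + a, … the order jumps
by at least two. If q ≥ ℓ, rewriting any sum of generators as an Apéry element plus a multiple of a
never shortens it; so the order can be read off from that normal form (`mem_foldSum_iff`), and it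
grows by one under addition of a. -/

/-! ### Cohen–Macaulay rings of dimension at most one -/

/-- By integrality, a prime over 0 is minimal and any other prime is maximal. In the first case the
empty sequence works; in the second, a nonzero element of the contraction is regular and the height
is 1. -/
theorem isCohenMacaulay_of_finite_of_torsionFree {P G : Type*} [CommRing P] [IsDomain P]
    [IsPrincipalIdealRing P] [CommRing G] [Algebra P G] [Module.Finite P G]
    (tf : ∀ p : P, p ≠ 0 → ∀ g : G, algebraMap P G p * g = 0 → g = 0) : IsCohenMacaulay G := by
  have hnoeth : IsNoetherianRing G := IsNoetherianRing.of_finite P G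
  have hmin : ∀ p : Ideal G, p.IsPrime → p.comap (algebraMap P G) = ⊥ → p ∈ minimalPrimes G := by
    intro p hp hp0
    refine ⟨⟨hp, bot_le⟩, fun q hq hqp => ?_⟩
    by_contra hne
    have hlt : q < p := lt_of_le_not_ge hqp hne
    have := hq.1
    have h2 := Ideal.IsIntegral.comap_lt_comap (R := P) hlt
    rw [hp0] at h2
    exact not_lt_bot h2
  have hdim : Ring.KrullDimLE 1 G := by
    refine Ring.KrullDimLE.mk₁ fun p hp => ?_
    by_cases hp0 : p.comap (algebraMap P G) = ⊥
    · exact Or.inl (hmin p hp hp0)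
    · right
      have : (p.comap (algebraMap P G)).IsMaximal :=
        IsPrime.to_maximal_ideal hp0
      exact Ideal.IsIntegral.isMaximal_of_isMaximal_comap (R := P) p this
  refine ⟨hnoeth, fun p hp => ⟨inferInstance, ?_⟩⟩
  by_cases hp0 : p.comap (algebraMap P G) = ⊥
  · refine ⟨[], by simp, RingTheory.Sequence.IsRegular.nil (Localization.AtPrime p)
      (Localization.AtPrime p), ?_⟩
    rw [IsLocalization.AtPrime.ringKrullDim_eq_height p,
      (Ideal.height_eq_zero_iff).2 (hmin p hp hp0)]
    simp
  · obtain ⟨g, hgp, hg0⟩ := Submodule.exists_mem_ne_zero_of_ne_bot hp0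
    have hgp' : algebraMap P G g ∈ p := hgp
    have hreg : ∀ y : G, algebraMap P G g * y = 0 → y = 0 := tf g hg0
    have hmem : ∀ r ∈ [algebraMap G (Localization.AtPrime p) (algebraMap P G g)],
        r ∈ IsLocalRing.maximalIdeal (Localization.AtPrime p) := by
      intro r hr
      rw [List.mem_singleton.1 hr]
      exact (IsLocalization.AtPrime.to_map_mem_maximal_iff _ p _).2 hgp'
    refine ⟨[algebraMap G (Localization.AtPrime p) (algebraMap P G g)], hmem, ?_, ?_⟩
    · refine RingTheory.Sequence.IsRegular.of_isWeaklyRegular_of_mem_maximalIdeal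
        (R := Localization.AtPrime p) (L := Localization.AtPrime p) hmem ?_
      rw [RingTheory.Sequence.isWeaklyRegular_singleton_iff]
      refine isSMulRegular_iff_right_eq_zero_of_smul.2 fun x hx => ?_
      obtain ⟨y, s, rfl⟩ := IsLocalization.exists_mk'_eq p.primeCompl x
      rw [smul_eq_mul, ← IsLocalization.mk'_one (M := p.primeCompl), ← IsLocalization.mk'_mul,
        IsLocalization.mk'_eq_zero_iff] at hx
      obtain ⟨m, hm⟩ := hx
      rw [IsLocalization.mk'_eq_zero_iff]
      exact ⟨m, hreg _ (by rw [← hm]; ring)⟩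
    · rw [IsLocalization.AtPrime.ringKrullDim_eq_height p]
      have h1 : p.height ≤ 1 := by
        have h2 : (p.height : WithBot ℕ∞) ≤ ringKrullDim G :=
          Ideal.height_le_ringKrullDim_of_ne_top hp.ne_top
        have h3 : ringKrullDim G ≤ 1 := by
          simpa using (Ring.krullDimLE_iff (R := G) (n := 1)).1 hdim
        exact_mod_cast h2.trans h3
      have h2 : p.height ≠ 0 := by
        intro h0
        refine notMem_nonZeroDivisors_of_mem_mem_minimalPrimes hgp'
          ((Ideal.height_eq_zero_iff).1 h0) ?_
        rw [mem_nonZeroDivisors_iff]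
        exact ⟨fun y hy => hreg y hy, fun y hy => hreg y (by rw [mul_comm]; exact hy)⟩
      have h3 : p.height = 1 := le_antisymm h1 (Order.one_le_iff_pos.2 (pos_iff_ne_zero.2 h2))
      rw [h3]; simp

/-- There are no embedded primes: if p is the annihilator of w, every element of the maximal ideal
at p kills the nonzero image of w, so the regular sequence is empty and p has height 0. -/
theorem IsCohenMacaulay.exists_minimalPrimes_annihilator_le {G : Type*} [CommRing G]
    (hG : IsCohenMacaulay G) {z : G} (hz : z ≠ 0) :
    ∃ p ∈ minimalPrimes G, ∀ y, y * z = 0 → y ∈ p := by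
  have := hG.noetherian
  obtain ⟨p, hp, hzp⟩ := exists_le_isAssociatedPrime_of_isNoetherianRing G z hz
  refine ⟨p, ?_, fun y hy => hzp (by simpa [Submodule.mem_colon_singleton] using hy)⟩
  have hpp := hp.isPrime
  obtain ⟨-, w, hw⟩ := isAssociatedPrime_iff.1 hp
  obtain ⟨-, rs, hmem, hreg, hdim⟩ := hG.localization p
  have hw0 : algebraMap G (Localization.AtPrime p) w ≠ 0 := by
    intro h0
    rw [IsLocalization.map_eq_zero_iff p.primeCompl] at h0
    obtain ⟨m, hm⟩ := h0
    exact m.2 (hw.ge (by simpa [Submodule.mem_colon_singleton] using hm))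
  rw [← Ideal.height_eq_zero_iff]
  rw [IsLocalization.AtPrime.ringKrullDim_eq_height p] at hdim
  cases rs with
  | nil => simpa using hdim
  | cons r rs =>
    exfalso
    obtain ⟨y, s, rfl⟩ := IsLocalization.exists_mk'_eq p.primeCompl r
    have hy : y ∈ p := by
      have := hmem _ List.mem_cons_self
      rwa [IsLocalization.AtPrime.mk'_mem_maximal_iff _ p] at this
    have h1 := ((RingTheory.Sequence.isWeaklyRegular_cons_iff _ _ _).1 hreg.toIsWeaklyRegular).1
    refine hw0 (isSMulRegular_iff_right_eq_zero_of_smul.1 h1 _ ?_)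
    rw [hw] at hy
    have hyw : y * w = 0 := by simpa [Submodule.mem_colon_singleton] using hy
    rw [smul_eq_mul, ← IsLocalization.mk'_one (M := p.primeCompl), ← IsLocalization.mk'_mul, hyw,
      IsLocalization.mk'_zero]

theorem exists_notMem_mul_pow_eq_zero_of_mem_minimalPrimes {G : Type*} [CommRing G] {p : Ideal G}
    (hp : p ∈ minimalPrimes G) {x : G} (hx : x ∈ p) : ∃ g ∉ p, ∃ N : ℕ, g * x ^ N = 0 := by
  have hpp : p.IsPrime := hp.1.1
  have hdim := Ring.KrullDimLE.of_isLocalization p hp (Localization.AtPrime p)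
  obtain ⟨N, hN⟩ := Ring.KrullDimLE.isNilpotent_iff_mem_maximalIdeal.2
    ((IsLocalization.AtPrime.to_map_mem_maximal_iff (Localization.AtPrime p) p x).2 hx)
  rw [← map_pow, IsLocalization.map_eq_zero_iff p.primeCompl] at hN
  obtain ⟨g, hg⟩ := hN
  exact ⟨g, g.2, N, hg⟩

/-! ### Powers of the graded maximal ideal as monomial ideals -/

namespace NumSemigroup

/-- The sums of an element of `H` and `r` nonzero elements of `H`. -/
def foldSum (H : AddSubmonoid ℕ) : ℕ → Set ℕ
  | 0 => H
  | r + 1 => {x | ∃ s ∈ foldSum H r, ∃ g ∈ H, g ≠ 0 ∧ x = s + g}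

theorem foldSum_subset (H : AddSubmonoid ℕ) (r : ℕ) : foldSum H r ⊆ H := by
  induction r with
  | zero => exact subset_rfl
  | succ r ih =>
    rintro _ ⟨s, hs, g, hg, -, rfl⟩
    exact H.add_mem (ih hs) hg

theorem foldSum_succ_subset (H : AddSubmonoid ℕ) (r : ℕ) : foldSum H (r + 1) ⊆ foldSum H r := by
  induction r with
  | zero => exact foldSum_subset H 1
  | succ r ih =>
    rintro _ ⟨s, hs, g, hg, hg0, rfl⟩
    exact ⟨s, ih hs, g, hg, hg0, rfl⟩

theorem foldSum_antitone (H : AddSubmonoid ℕ) : Antitone (foldSum H) :=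
  antitone_nat_of_succ_le (foldSum_succ_subset H)

theorem le_of_mem_foldSum {H : AddSubmonoid ℕ} {a : ℕ} (ha : IsMultiplicity H a) {r s : ℕ}
    (hs : s ∈ foldSum H r) : r * a ≤ s := by
  induction r generalizing s with
  | zero => simp
  | succ r ih =>
    obtain ⟨s, hs, g, hg, hg0, rfl⟩ := hs
    have := ih hs
    have := ha.2 ⟨hg, hg0⟩
    rw [add_mul]; omega

theorem add_mul_mem_foldSum {H : AddSubmonoid ℕ} {r s g : ℕ} (hs : s ∈ foldSum H r) (hg : g ∈ H)
    (hg0 : g ≠ 0) (j : ℕ) : s + j * g ∈ foldSum H (r + j) := by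
  induction j with
  | zero => simpa using hs
  | succ j ih => exact ⟨_, ih, g, hg, hg0, by ring⟩

theorem add_mem_foldSum {H : AddSubmonoid ℕ} {r r' s s' : ℕ} (hs : s ∈ foldSum H r)
    (hs' : s' ∈ foldSum H r') : s + s' ∈ foldSum H (r + r') := by
  induction r' generalizing s' with
  | zero =>
    cases r with
    | zero => exact H.add_mem hs hs'
    -- The innermost summand of `s`, which is an arbitrary element of `H`, absorbs `s'`.
    | succ r =>
      obtain ⟨u, hu, g, hg, hg0, rfl⟩ := hs
      induction r generalizing u g with
      | zero => exact ⟨u + s', H.add_mem hu hs', g, hg, hg0, by ring⟩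
      | succ r ih =>
        obtain ⟨v, hv, g', hg', hg0', rfl⟩ := hu
        exact ⟨_, ih v hv g' hg' hg0', g, hg, hg0, by ring⟩
  | succ r' ih =>
    obtain ⟨u, hu, g, hg, hg0, rfl⟩ := hs'
    exact ⟨s + u, ih hu, g, hg, hg0, by ring⟩

variable {k : Type*} [Field k] {H : AddSubmonoid ℕ}

theorem mem_of_coeff_ne_zero (y : semigroupRing k H) {s : ℕ} (hs : (y : k[X]).coeff s ≠ 0) :
    s ∈ H := by
  obtain ⟨y, hy⟩ := y
  change y.coeff s ≠ 0 at hs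
  induction hy using Algebra.adjoin_induction generalizing s with
  | mem f hf =>
    obtain ⟨u, hu, rfl⟩ := hf
    rw [coeff_X_pow] at hs
    have : s = u := by by_contra h; simp [h] at hs
    exact this ▸ hu
  | algebraMap c =>
    have : s = 0 := by
      by_contra h
      rw [← C_eq_algebraMap, coeff_C] at hs
      simp [h] at hs
    exact this ▸ H.zero_mem
  | add f g _ _ hf hg =>
    rw [coeff_add] at hs
    by_cases h : f.coeff s = 0
    · exact hg fun h' => hs (by rw [h, h', add_zero])
    · exact hf h
  | mul f g _ _ hf hg =>
    rw [coeff_mul] at hs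
    obtain ⟨⟨i, j⟩, hij, hne⟩ := Finset.exists_ne_zero_of_sum_ne_zero hs
    rw [← Finset.HasAntidiagonal.mem_antidiagonal.1 hij]
    exact H.add_mem (hf (left_ne_zero_of_mul hne)) (hg (right_ne_zero_of_mul hne))

theorem tpow_add (s u : H) : tpow k (s + u) = tpow k s * tpow k u :=
  Subtype.ext (pow_add X (s : ℕ) (u : ℕ))

theorem tpow_zero : tpow k (0 : H) = 1 := Subtype.ext (pow_zero X)

theorem tpow_nsmul (j : ℕ) (s : H) : tpow k (j • s) = tpow k s ^ j := by
  induction j with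
  | zero => rw [zero_smul, pow_zero, tpow_zero]
  | succ j ih => rw [succ_nsmul, tpow_add, ih, pow_succ]

theorem tpow_mem_gradedMaximalIdeal {s : H} (hs : (s : ℕ) ≠ 0) :
    tpow k s ∈ gradedMaximalIdeal k H :=
  Ideal.subset_span ⟨s, hs, rfl⟩

theorem tpow_mem_pow {r : ℕ} {s : H} (hs : (s : ℕ) ∈ foldSum H r) :
    tpow k s ∈ gradedMaximalIdeal k H ^ r := by
  induction r generalizing s with
  | zero => simp
  | succ r ih =>
    obtain ⟨s, hs'⟩ := s
    obtain ⟨u, hu, g, hg, hg0, rfl⟩ := hs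
    have := Ideal.mul_mem_mul (ih (s := ⟨u, foldSum_subset H r hu⟩) hu)
      (tpow_mem_gradedMaximalIdeal (k := k) (s := ⟨g, hg⟩) hg0)
    rw [← tpow_add, ← pow_succ] at this
    exact this

theorem eq_sum_smul_tpow (y : semigroupRing k H) :
    y = ∑ s ∈ (y : k[X]).support.attach,
      (y : k[X]).coeff s • tpow k ⟨s, mem_of_coeff_ne_zero y (mem_support_iff.1 s.2)⟩ := by
  apply Subtype.ext
  rw [AddSubmonoidClass.coe_finsetSum]
  conv_lhs => rw [as_sum_support_C_mul_X_pow (y : k[X])]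
  rw [← Finset.sum_attach]
  refine Finset.sum_congr rfl fun s _ => ?_
  rw [← smul_eq_C_mul]
  rfl

theorem coeff_mul_tpow (y : semigroupRing k H) (s : H) (u : ℕ) :
    ((y * tpow k s : semigroupRing k H) : k[X]).coeff (u + s) = (y : k[X]).coeff u :=
  coeff_mul_X_pow _ _ _

/-- Powers of a monomial ideal are monomial, so membership is tested exponent by exponent. This
reduces the tangent cone to the combinatorics of `foldSum`. -/
theorem mem_pow_iff {r : ℕ} {y : semigroupRing k H} :
    y ∈ gradedMaximalIdeal k H ^ r ↔ ∀ s, (y : k[X]).coeff s ≠ 0 → s ∈ foldSum H r := by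
  constructor
  · have hmul : ∀ (r : ℕ) (f g : semigroupRing k H),
        (∀ s, (f : k[X]).coeff s ≠ 0 → s ∈ foldSum H r) →
        (∀ s, (g : k[X]).coeff s ≠ 0 → s ∈ foldSum H 1) →
        ∀ s, ((f * g : semigroupRing k H) : k[X]).coeff s ≠ 0 → s ∈ foldSum H (r + 1) := by
      intro r f g hf hg s hs
      rw [MulMemClass.coe_mul, coeff_mul] at hs
      obtain ⟨⟨i, j⟩, hij, hne⟩ := Finset.exists_ne_zero_of_sum_ne_zero hs
      rw [← Finset.HasAntidiagonal.mem_antidiagonal.1 hij]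
      exact add_mem_foldSum (hf i (left_ne_zero_of_mul hne)) (hg j (right_ne_zero_of_mul hne))
    have hadd : ∀ (r : ℕ) (f g : semigroupRing k H),
        (∀ s, (f : k[X]).coeff s ≠ 0 → s ∈ foldSum H r) →
        (∀ s, (g : k[X]).coeff s ≠ 0 → s ∈ foldSum H r) →
        ∀ s, ((f + g : semigroupRing k H) : k[X]).coeff s ≠ 0 → s ∈ foldSum H r := by
      intro r f g hf hg s hs
      rw [AddMemClass.coe_add, coeff_add] at hs
      by_cases h : (f : k[X]).coeff s = 0
      · exact hg s fun h' => hs (by rw [h, h', add_zero])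
      · exact hf s h
    have hone : ∀ f ∈ gradedMaximalIdeal k H,
        ∀ s, (f : k[X]).coeff s ≠ 0 → s ∈ foldSum H 1 := by
      intro f hf
      refine Submodule.span_induction ?_ ?_ (fun f g _ _ => hadd 1 f g) ?_ hf
      · rintro _ ⟨u, hu, rfl⟩ s hs
        have h1 : s = u := by
          by_contra h
          exact hs (by change (X ^ (u : ℕ) : k[X]).coeff s = 0; simp [coeff_X_pow, h])
        exact ⟨0, H.zero_mem, u, u.2, hu, by rw [h1, zero_add]⟩
      · intro s hs
        exact absurd (coeff_zero s) hs
      · intro c f _ hf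
        rw [smul_eq_mul]
        exact hmul 0 c f (fun s hs => mem_of_coeff_ne_zero c hs) hf
    intro hy
    induction r generalizing y with
    | zero => exact fun s hs => mem_of_coeff_ne_zero y hs
    | succ r ih =>
      rw [pow_succ] at hy
      exact Submodule.mul_induction_on hy (fun f hf g hg => hmul r f g (ih hf) (hone g hg))
        (hadd (r + 1))
  · intro h
    rw [eq_sum_smul_tpow y]
    refine Ideal.sum_mem _ fun s _ => ?_
    exact Submodule.smul_of_tower_mem _ _ (tpow_mem_pow (h s (mem_support_iff.1 s.2)))

theorem tpow_mem_pow_iff {r : ℕ} {s : H} :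
    tpow k s ∈ gradedMaximalIdeal k H ^ r ↔ (s : ℕ) ∈ foldSum H r := by
  refine ⟨fun h => mem_pow_iff.1 h s ?_, tpow_mem_pow⟩
  change (X ^ (s : ℕ) : k[X]).coeff s ≠ 0
  simp

theorem pow_induction {r : ℕ} {p : ↥(gradedMaximalIdeal k H ^ r) → Prop} (zero : p 0)
    (add : ∀ x y, p x → p y → p (x + y))
    (monomial : ∀ (c : k) (s : H) (hs : (s : ℕ) ∈ foldSum H r),
      p ⟨c • tpow k s, Submodule.smul_of_tower_mem _ c (tpow_mem_pow hs)⟩)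
    (y : ↥(gradedMaximalIdeal k H ^ r)) : p y := by
  have hy := mem_pow_iff.1 y.2
  have : y = ∑ s ∈ ((y : semigroupRing k H) : k[X]).support.attach,
      ⟨((y : semigroupRing k H) : k[X]).coeff s •
        tpow k ⟨s, mem_of_coeff_ne_zero y.1 (mem_support_iff.1 s.2)⟩,
        Submodule.smul_of_tower_mem _ _ (tpow_mem_pow (hy s (mem_support_iff.1 s.2)))⟩ := by
    apply Subtype.ext
    rw [AddSubmonoidClass.coe_finsetSum]
    exact eq_sum_smul_tpow y.1
  rw [this]
  exact Finset.sum_induction _ p add zero fun s _ =>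
    monomial _ _ (hy s (mem_support_iff.1 s.2))

end NumSemigroup

/-! ### Forms in the associated graded ring and its structure over k[X] -/

namespace GrPiece

variable {R : Type*} [CommRing R] {I : Ideal R}

/-- The form of degree `r` of the associated graded ring defined by an element of `I ^ r`. -/
def form (I : Ideal R) (r : ℕ) (y : ↥(I ^ r)) : AssociatedGradedRing I :=
  DirectSum.of (GrPiece I) r (cls I r y)

theorem form_add (r : ℕ) (y z : ↥(I ^ r)) : form I r (y + z) = form I r y + form I r z := by
  rw [form, map_add, map_add]; rfl

theorem form_zero (r : ℕ) : form I r 0 = 0 := by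
  rw [form, map_zero, map_zero]

theorem form_congr {r s : ℕ} {y : ↥(I ^ r)} {z : ↥(I ^ s)} (hrs : r = s) (h : (y : R) = z) :
    form I r y = form I s z := by
  subst hrs
  rw [Subtype.ext h]

theorem form_eq_zero_iff {r : ℕ} {y : ↥(I ^ r)} : form I r y = 0 ↔ (y : R) ∈ I ^ (r + 1) := by
  rw [form, ← map_zero (DirectSum.of (GrPiece I) r), (DirectSum.of_injective r).eq_iff,
    ← map_zero (cls I r), cls_eq_iff]
  simp

theorem form_mul {r s : ℕ} (y : ↥(I ^ r)) (z : ↥(I ^ s)) :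
    form I r y * form I s z = form I (r + s) (mulElt I y z) := by
  rw [form, form, DirectSum.of_mul_of]; rfl

theorem form_one : form I 0 ⟨1, by simp⟩ = 1 := rfl

theorem form_pow {r : ℕ} (y : ↥(I ^ r)) (j : ℕ) :
    form I r y ^ j = form I (r * j) ⟨(y : R) ^ j, by
      rw [pow_mul]; exact Ideal.pow_mem_pow y.2 j⟩ := by
  induction j with
  | zero => rw [pow_zero, ← form_one]; exact form_congr rfl (by simp)
  | succ j ih => rw [pow_succ, ih, form_mul]; exact form_congr (by ring) (by simp [mulElt, pow_succ])

theorem induction {p : AssociatedGradedRing I → Prop} (zero : p 0)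
    (add : ∀ x y, p x → p y → p (x + y)) (hform : ∀ r y, p (form I r y))
    (g : AssociatedGradedRing I) : p g := by
  induction g using DirectSum.induction_on with
  | zero => exact zero
  | of i x =>
    obtain ⟨y, rfl⟩ := cls_surjective I i x
    exact hform i y
  | add x y hx hy => exact add x y hx hy

theorem mul_form_apply (g : AssociatedGradedRing I) {r : ℕ} (y : ↥(I ^ r)) (d : ℕ) :
    (g * form I r y) (d + r) = mul I (g d) (cls I r y) := by
  induction g using induction with
  | zero =>
    rw [zero_mul]
    exact ((gCommRing I).zero_mul _).symm
  | add x z hx hz =>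
    rw [add_mul, DirectSum.add_apply, hx, hz, DirectSum.add_apply]
    exact ((gCommRing I).add_mul _ _ _).symm
  | hform e z =>
    rw [form_mul]
    by_cases h : e = d
    · subst h
      rw [form, DirectSum.of_eq_same, form, DirectSum.of_eq_same, mul_cls]
    · rw [form, DirectSum.of_eq_of_ne _ _ _ (by omega), form, DirectSum.of_eq_of_ne _ _ _ (by omega)]
      exact ((gCommRing I).zero_mul _).symm

theorem mul_form_apply_of_lt (g : AssociatedGradedRing I) {r : ℕ} (y : ↥(I ^ r)) {d : ℕ}
    (hd : d < r) : (g * form I r y) d = 0 := by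
  induction g using induction with
  | zero => rw [zero_mul, DirectSum.zero_apply]
  | add x z hx hz => rw [add_mul, DirectSum.add_apply, hx, hz, add_zero]
  | hform e z => rw [form_mul, form, DirectSum.of_eq_of_ne _ _ _ (by omega)]

theorem eq_zero_of_mul_form_eq_zero {t : ↥(I ^ 1)}
    (ht : ∀ d, ∀ y ∈ I ^ d, y * (t : R) ∈ I ^ (d + 2) → y ∈ I ^ (d + 1))
    {g : AssociatedGradedRing I} (hg : g * form I 1 t = 0) : g = 0 := by
  refine DFinsupp.ext fun d => ?_
  obtain ⟨y, hy⟩ := cls_surjective I d (g d)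
  have h := mul_form_apply g t d
  rw [hg, DirectSum.zero_apply, ← hy, mul_cls] at h
  have h2 := (cls_eq_iff I (mulElt I y t) 0).1 (h.symm.trans (map_zero _).symm)
  rw [ZeroMemClass.coe_zero, sub_zero] at h2
  rw [← hy]
  exact ((cls_eq_iff I y 0).2 (by simpa using ht d y y.2 h2)).trans (map_zero _)

/-- Iterating makes g divisible by every power of a form of degree 1, while a multiple of its N-th
power has no component below degree N. -/
theorem eq_zero_of_eq_mul_form {t : ↥(I ^ 1)} {g w : AssociatedGradedRing I}
    (hg : g = w * g * form I 1 t) : g = 0 := by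
  have h : ∀ N : ℕ, g = w ^ N * g * form I 1 t ^ N := by
    intro N
    induction N with
    | zero => simp
    | succ N ih =>
      calc g = w ^ N * g * form I 1 t ^ N := ih
        _ = w ^ N * (w * g * form I 1 t) * form I 1 t ^ N := by rw [← hg]
        _ = _ := by ring
  refine DFinsupp.ext fun d => ?_
  rw [h (d + 1), form_pow]
  exact mul_form_apply_of_lt _ _ (by omega)

/-- The ring homomorphism from `R` to the associated graded ring of an ideal of `R`. -/
def constHom (I : Ideal R) : R →+* AssociatedGradedRing I where
  toFun r := form I 0 ⟨r, by simp⟩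
  map_one' := rfl
  map_zero' := form_zero 0
  map_add' x y := form_add 0 ⟨x, by simp⟩ ⟨y, by simp⟩
  map_mul' x y := by rw [form_mul]; exact form_congr rfl rfl

theorem constHom_mul_form (c : R) {r : ℕ} (y : ↥(I ^ r)) :
    constHom I c * form I r y = form I r ⟨c * y, Ideal.mul_mem_left _ _ y.2⟩ := by
  change form I 0 _ * _ = _
  rw [form_mul]; exact form_congr (zero_add r) rfl

variable {k : Type*} [Field k] [Algebra k R]

/-- The ring homomorphism from `k[X]` to the associated graded ring that sends `X` to the form
defined by `t`. -/
noncomputable def polyHom (k : Type*) [Field k] [Algebra k R] (t : ↥(I ^ 1)) :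
    k[X] →+* AssociatedGradedRing I :=
  eval₂RingHom ((constHom I).comp (algebraMap k R)) (form I 1 t)

theorem polyHom_X (t : ↥(I ^ 1)) : polyHom k t X = form I 1 t := eval₂_X _ _

theorem polyHom_C (t : ↥(I ^ 1)) (c : k) :
    polyHom k t (C c) = constHom I (algebraMap k R c) := eval₂_C _ _

/-- Powers of X are cancelled because X acts injectively. Once the constant term is a unit, the
equation reads g = w g X, and the grading forces g = 0. -/
theorem eq_zero_of_polyHom_mul_eq_zero {t : ↥(I ^ 1)}
    (ht : ∀ d, ∀ y ∈ I ^ d, y * (t : R) ∈ I ^ (d + 2) → y ∈ I ^ (d + 1))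
    {p : k[X]} (hp : p ≠ 0) {g : AssociatedGradedRing I} (hg : polyHom k t p * g = 0) :
    g = 0 := by
  induction hN : p.natDegree using Nat.strong_induction_on generalizing p with
  | _ N ih =>
    have hdiv := divX_mul_X_add p
    by_cases h0 : p.coeff 0 = 0
    · rw [h0, C_0, add_zero] at hdiv
      have hq : p.divX ≠ 0 := by
        intro h; rw [h, zero_mul] at hdiv; exact hp hdiv.symm
      refine ih p.divX.natDegree ?_ hq ?_ rfl
      · rw [← hN]; conv_rhs => rw [← hdiv]
        rw [natDegree_mul_X hq]; omega
      · refine eq_zero_of_mul_form_eq_zero ht ?_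
        rw [← polyHom_X (k := k), mul_right_comm, ← map_mul, hdiv, hg]
    · refine eq_zero_of_eq_mul_form (t := t) (w := -(polyHom k t (C (p.coeff 0)⁻¹ * p.divX))) ?_
      have h1 : polyHom k t (C (p.coeff 0)⁻¹) * polyHom k t (C (p.coeff 0)) = 1 := by
        rw [← map_mul, ← C_mul, inv_mul_cancel₀ h0, C_1, map_one]
      rw [← hdiv, map_add, map_mul, polyHom_X] at hg
      rw [map_mul]
      linear_combination (-g) * h1 + polyHom k t (C (p.coeff 0)⁻¹) * hg

end GrPiece

/-! ### The order criterion for Cohen–Macaulayness of the tangent cone -/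

namespace NumSemigroup

variable {k : Type*} [Field k] {H : AddSubmonoid ℕ}

theorem mem_foldSum_one {s : ℕ} (hs : s ∈ H) (hs0 : s ≠ 0) : s ∈ foldSum H 1 :=
  ⟨0, H.zero_mem, s, hs, hs0, (zero_add s).symm⟩

/-- The form of degree `r` defined by `t ^ s` in the tangent cone. -/
noncomputable def monomialForm (k : Type*) [Field k] {H : AddSubmonoid ℕ} (r : ℕ) (s : H)
    (hs : (s : ℕ) ∈ foldSum H r) : TangentCone k H :=
  GrPiece.form (gradedMaximalIdeal k H) r ⟨tpow k s, tpow_mem_pow hs⟩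

theorem monomialForm_congr {r r' : ℕ} {s s' : H} {hs : (s : ℕ) ∈ foldSum H r}
    {hs' : (s' : ℕ) ∈ foldSum H r'} (hr : r = r') (hss : (s : ℕ) = s') :
    monomialForm k r s hs = monomialForm k r' s' hs' :=
  GrPiece.form_congr hr (congrArg (tpow k) (Subtype.ext hss))

theorem monomialForm_eq_zero_iff {r : ℕ} {s : H} {hs : (s : ℕ) ∈ foldSum H r} :
    monomialForm k r s hs = 0 ↔ (s : ℕ) ∈ foldSum H (r + 1) := by
  rw [monomialForm, GrPiece.form_eq_zero_iff, tpow_mem_pow_iff]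

theorem monomialForm_mul {r r' : ℕ} {s s' : H} (hs : (s : ℕ) ∈ foldSum H r)
    (hs' : (s' : ℕ) ∈ foldSum H r') :
    monomialForm k r s hs * monomialForm k r' s' hs' =
      monomialForm k (r + r') (s + s') (add_mem_foldSum hs hs') := by
  rw [monomialForm, monomialForm, GrPiece.form_mul]
  exact GrPiece.form_congr rfl (tpow_add s s').symm

theorem nsmul_mem_foldSum {r s : ℕ} (hs : s ∈ foldSum H r) (j : ℕ) : j • s ∈ foldSum H (r * j) := by
  induction j with
  | zero => rw [zero_smul]; exact H.zero_mem
  | succ j ih => rw [succ_nsmul, mul_add, mul_one]; exact add_mem_foldSum ih hs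

theorem monomialForm_pow {r : ℕ} {s : H} (hs : (s : ℕ) ∈ foldSum H r) (j : ℕ) :
    monomialForm k r s hs ^ j = monomialForm k (r * j) (j • s) (nsmul_mem_foldSum hs j) := by
  rw [monomialForm, GrPiece.form_pow]
  exact GrPiece.form_congr rfl (tpow_nsmul j s).symm

theorem form_smul_tpow (c : k) {r : ℕ} {s : H} (hs : (s : ℕ) ∈ foldSum H r)
    (h : c • tpow k s ∈ gradedMaximalIdeal k H ^ r) :
    GrPiece.form (gradedMaximalIdeal k H) r ⟨c • tpow k s, h⟩ =
      GrPiece.constHom _ (algebraMap k (semigroupRing k H) c) * monomialForm k r s hs := by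
  rw [monomialForm, GrPiece.constHom_mul_form]
  exact GrPiece.form_congr rfl (Algebra.smul_def _ _)

/-- If the order of the elements of `H` increases by exactly one under the addition of `a`, then
the tangent cone is Cohen-Macaulay. -/
theorem isCohenMacaulay_tangentCone {a : ℕ} (ha : a ∈ H) (ha0 : a ≠ 0) {f : ℕ → ℕ}
    (hf : ∀ r s, s ∈ foldSum H r ↔ s ∈ H ∧ r ≤ f s) (hfa : ∀ s ∈ H, f (s + a) = f s + 1)
    {W : Set ℕ} (hWfin : W.Finite) (hWH : W ⊆ H) (hW : ∀ s ∈ H, ∃ w ∈ W, ∃ j, s = w + j * a) :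
    IsCohenMacaulay (TangentCone k H) := by
  let t : ↥(gradedMaximalIdeal k H ^ 1) :=
    ⟨tpow k ⟨a, ha⟩, tpow_mem_pow (mem_foldSum_one ha ha0)⟩
  have ht : ∀ d, ∀ y ∈ gradedMaximalIdeal k H ^ d,
      y * (t : semigroupRing k H) ∈ gradedMaximalIdeal k H ^ (d + 2) →
      y ∈ gradedMaximalIdeal k H ^ (d + 1) := by
    intro d y _ hyt
    rw [mem_pow_iff] at hyt ⊢
    intro s hs
    have hsH := mem_of_coeff_ne_zero y hs
    have h1 := hyt (s + a) (by rw [coeff_mul_tpow y ⟨a, ha⟩ s]; exact hs)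
    rw [hf, hfa s hsH] at h1
    exact (hf _ _).2 ⟨hsH, by omega⟩
  let φ : k[X] →+* TangentCone k H := GrPiece.polyHom k t
  let : Algebra k[X] (TangentCone k H) := φ.toAlgebra
  have hX : φ X = monomialForm k 1 ⟨a, ha⟩ (mem_foldSum_one ha ha0) := GrPiece.polyHom_X t
  have hmem : ∀ w : W, (w : ℕ) ∈ foldSum H (f w) := fun w => (hf _ _).2 ⟨hWH w.2, le_rfl⟩
  have hfin : Module.Finite k[X] (TangentCone k H) := by
    refine ⟨Submodule.fg_def.2 ⟨Set.range fun w : W =>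
      monomialForm k (f w) ⟨w, hWH w.2⟩ (hmem w), ?_, ?_⟩⟩
    · have := hWfin.to_subtype
      exact Set.finite_range _
    refine Submodule.eq_top_iff'.2 fun g => ?_
    induction g using GrPiece.induction with
    | zero => exact Submodule.zero_mem _
    | add x y hx hy => exact Submodule.add_mem _ hx hy
    | hform r y =>
      induction y using pow_induction with
      | zero => rw [GrPiece.form_zero]; exact Submodule.zero_mem _
      | add x y hx hy => rw [GrPiece.form_add]; exact Submodule.add_mem _ hx hy
      | monomial c s hs =>
        rw [form_smul_tpow c hs]
        obtain ⟨w, hw, j, hj⟩ := hW s s.2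
        have hfj : ∀ j, f (w + j * a) = f w + j := by
          intro j
          induction j with
          | zero => simp
          | succ j ih =>
            rw [add_mul, one_mul, ← add_assoc, hfa _ (H.add_mem (hWH hw) (by
              simpa using H.nsmul_mem ha j)), ih]; ring
        have hr := ((hf _ _).1 hs).2
        -- If r is the order of s, the form of t^s is X^j times that of t^w, because each a adds
        -- exactly one to the order. If r is smaller, the form vanishes.
        rcases hr.eq_or_lt with hr | hr
        · have hsplit : monomialForm k r s hs =
              φ (X ^ j) * monomialForm k (f w) ⟨w, hWH hw⟩ (hmem ⟨w, hw⟩) := by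
            rw [map_pow, hX, monomialForm_pow, monomialForm_mul]
            refine monomialForm_congr ?_ ?_
            · rw [hr, hj, hfj]; ring
            · rw [hj]; simp [add_comm]
          have hC : GrPiece.constHom _ (algebraMap k (semigroupRing k H) c) = φ (C c) :=
            (GrPiece.polyHom_C t c).symm
          rw [hsplit, hC, ← mul_assoc, ← map_mul]
          exact Submodule.smul_mem _ (C c * X ^ j) (Submodule.subset_span ⟨⟨w, hw⟩, rfl⟩)
        · rw [monomialForm_eq_zero_iff.2 ((hf _ _).2 ⟨s.2, hr⟩), mul_zero]
          exact Submodule.zero_mem _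
  exact isCohenMacaulay_of_finite_of_torsionFree (P := k[X]) fun p hp g hg =>
    GrPiece.eq_zero_of_polyHom_mul_eq_zero ht hp hg

/-- If adding the multiplicity to some element of `H` raises its order by more than one, then the
tangent cone is not Cohen-Macaulay. -/
theorem not_isCohenMacaulay_tangentCone {a : ℕ} (ha : IsMultiplicity H a) {r s : ℕ}
    (hs : s ∈ foldSum H r) (hs' : s ∉ foldSum H (r + 1)) (hsa : s + a ∈ foldSum H (r + 2)) :
    ¬ IsCohenMacaulay (TangentCone k H) := by
  intro hCM
  have ha0 : a ≠ 0 := ha.1.2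
  have ha1 : a ∈ foldSum H 1 := mem_foldSum_one ha.1.1 ha0
  have hz : monomialForm k r ⟨s, foldSum_subset H r hs⟩ hs ≠ 0 := fun h =>
    hs' (monomialForm_eq_zero_iff.1 h)
  obtain ⟨p, hp, hzp⟩ := hCM.exists_minimalPrimes_annihilator_le hz
  have hpp : p.IsPrime := hp.1.1
  have hx : monomialForm k 1 ⟨a, ha.1.1⟩ ha1 ∈ p := by
    refine hzp _ ?_
    rw [monomialForm_mul, monomialForm_eq_zero_iff]
    change a + s ∈ foldSum H (1 + r + 1)
    rw [add_comm a s, show 1 + r + 1 = r + 2 by ring]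
    exact hsa
  -- The prime p contains all positive degrees. The a-th power of the form of t^u in degree d has
  -- exponent au, a sum of u copies of a. It is a power of the form of t^a if u = da, and zero if u
  -- > da, since its order then exceeds da.
  have hmon : ∀ (d : ℕ) (u : H) (hu : (u : ℕ) ∈ foldSum H d), d ≠ 0 →
      monomialForm k d u hu ∈ p := by
    intro d u hu hd
    refine hpp.mem_of_pow_mem a ?_
    rw [monomialForm_pow]
    rcases (le_of_mem_foldSum ha hu).eq_or_lt with h | h
    · have : monomialForm k (d * a) (a • u) (nsmul_mem_foldSum hu a) =
          monomialForm k 1 ⟨a, ha.1.1⟩ ha1 ^ (u : ℕ) := by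
        rw [monomialForm_pow]
        refine monomialForm_congr (by rw [← h]; ring) ?_
        change a • (u : ℕ) = (u : ℕ) • a
        simp [mul_comm]
      rw [this]
      refine p.pow_mem_of_mem hx _ (Nat.pos_of_ne_zero fun h0 => ?_)
      rw [h0] at h
      exact (mul_ne_zero hd ha0) h
    · rw [monomialForm_eq_zero_iff.2]
      · exact p.zero_mem
      · have h2 := nsmul_mem_foldSum ha1 (u : ℕ)
        rw [one_mul] at h2
        have h3 := foldSum_antitone H h h2
        change a • (u : ℕ) ∈ foldSum H (d * a + 1)
        rw [smul_eq_mul, mul_comm a]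
        exact h3
  have hpos : ∀ (d : ℕ) (y : ↥(gradedMaximalIdeal k H ^ d)), d ≠ 0 →
      GrPiece.form _ d y ∈ p := by
    intro d y hd
    induction y using pow_induction with
    | zero => rw [GrPiece.form_zero]; exact p.zero_mem
    | add x y hx hy => rw [GrPiece.form_add]; exact p.add_mem hx hy
    | monomial c s hs => rw [form_smul_tpow c hs]; exact p.mul_mem_left _ (hmon _ _ _ hd)
  -- Minimality of p now gives the contradiction: g is congruent to its constant component modulo p.
  -- That component is zero, because a nonzero constant term would put Na into `foldSum H (N + 1)`,
  -- whose elements are at least (N + 1)a.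
  obtain ⟨g, hg, N, hN⟩ := exists_notMem_mul_pow_eq_zero_of_mem_minimalPrimes hp hx
  have hg0 : g - DirectSum.of (GrPiece (gradedMaximalIdeal k H)) 0 (g 0) ∈ p := by
    have : ∀ g : TangentCone k H,
        g - DirectSum.of (GrPiece (gradedMaximalIdeal k H)) 0 (g 0) ∈ p := by
      intro g
      induction g using GrPiece.induction with
      | zero => simp
      | add x y hx hy =>
        rw [DirectSum.add_apply, map_add, add_sub_add_comm]
        exact p.add_mem hx hy
      | hform r y =>
        by_cases hr : r = 0
        · subst hr
          rw [GrPiece.form, DirectSum.of_eq_same, sub_self]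
          exact p.zero_mem
        · rw [GrPiece.form, DirectSum.of_eq_of_ne _ _ _ (Ne.symm hr), map_zero, sub_zero]
          exact hpos r y hr
    exact this g
  obtain ⟨y, hy⟩ := GrPiece.cls_surjective _ 0 (g 0)
  have h1 := GrPiece.mul_form_apply g
    ⟨tpow k (N • ⟨a, ha.1.1⟩ : H), tpow_mem_pow (nsmul_mem_foldSum ha1 N)⟩ 0
  rw [monomialForm_pow, monomialForm] at hN
  rw [hN, DirectSum.zero_apply, ← hy, GrPiece.mul_cls] at h1
  have h2 := (GrPiece.cls_eq_iff _ _ 0).1 (h1.symm.trans (map_zero _).symm)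
  rw [ZeroMemClass.coe_zero, sub_zero] at h2
  have h3 : (y : semigroupRing k H) ∈ gradedMaximalIdeal k H ^ 1 := by
    rw [mem_pow_iff] at h2 ⊢
    intro u hu
    have huH := mem_of_coeff_ne_zero _ hu
    refine mem_foldSum_one huH fun hu0 => ?_
    have h4 := le_of_mem_foldSum ha (h2 (u + (N • ⟨a, ha.1.1⟩ : H))
      (by rw [GrPiece.mulElt, coeff_mul_tpow]; exact hu))
    rw [hu0] at h4
    change (0 + 1 * N + 1) * a ≤ 0 + N • a at h4
    rw [smul_eq_mul] at h4
    have : 0 < a := Nat.pos_of_ne_zero ha0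
    nlinarith
  have h5 : DirectSum.of (GrPiece (gradedMaximalIdeal k H)) 0 (g 0) = 0 := by
    rw [← hy]
    exact GrPiece.form_eq_zero_iff.2 h3
  rw [h5, sub_zero] at hg0
  exact hg hg0

end NumSemigroup

/-! ### Minimal generators and progressions in ℤ/a -/

namespace NumSemigroup

theorem mem_closure_diff_of_lt {A : Set ℕ} {g x : ℕ} (hx : x ∈ AddSubmonoid.closure A)
    (hxg : x < g) : x ∈ AddSubmonoid.closure (A \ {g}) := by
  induction hx using AddSubmonoid.closure_induction with
  | mem x hx => exact AddSubmonoid.subset_closure ⟨hx, hxg.ne⟩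
  | zero => exact AddSubmonoid.zero_mem _
  | add x y _ _ hx hy => exact AddSubmonoid.add_mem _ (hx (by omega)) (hy (by omega))

theorem IsMinimalGenerators.ne_add {H : AddSubmonoid ℕ} {A : Set ℕ} (hA : IsMinimalGenerators H A)
    {g u v : ℕ} (hg : g ∈ A) (hu : u ∈ H) (hv : v ∈ H) (hu0 : u ≠ 0) (hv0 : v ≠ 0) :
    g ≠ u + v := by
  intro h
  have hcl : AddSubmonoid.closure A = H := hA.1
  rw [← hcl] at hu hv
  have hmem : g ∈ AddSubmonoid.closure (A \ {g}) := by
    have := AddSubmonoid.add_mem _ (mem_closure_diff_of_lt (g := g) hu (by omega))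
      (mem_closure_diff_of_lt (g := g) hv (by omega))
    rwa [← h] at this
  have hcl' : AddSubmonoid.closure (A \ {g}) = H := by
    refine le_antisymm (hcl ▸ AddSubmonoid.closure_mono Set.sdiff_subset) ?_
    rw [← hcl, AddSubmonoid.closure_le]
    intro x hx
    by_cases hxg : x = g
    · exact hxg ▸ hmem
    · exact AddSubmonoid.subset_closure ⟨hx, hxg⟩
  exact (hA.2 hcl' Set.sdiff_subset hg).2 rfl

/-- If a ring is partitioned into an arithmetic progression starting at `0` with difference `β` and
one with difference `γ` that contains the next multiple of `β` as its last term, then the second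
progression starts at `γ` and `β = -γ`. -/
theorem eq_neg_of_partition_progressions {Z : Type*} [CommRing Z] {β γ η : Z} {ℓ N : ℕ}
    (hℓ : 2 ≤ ℓ) (hN : 2 ≤ N)
    (hcov : ∀ z : Z, (∃ i < ℓ, z = i * β) ∨ ∃ i, 1 ≤ i ∧ i ≤ N ∧ z = η + i * γ)
    (hdisj : ∀ i < ℓ, ∀ j, 1 ≤ j → j ≤ N → (i : Z) * β ≠ η + j * γ)
    (hinjS : ∀ i < ℓ, ∀ j < ℓ, (i : Z) * β = j * β → i = j)
    (hγ : γ ≠ 0) (hlast : (ℓ : Z) * β = η + N * γ) : η = 0 ∧ β = -γ := by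
  have hzero : ∀ j, 1 ≤ j → j ≤ N → η + (j : Z) * γ ≠ 0 := fun j h1 h2 h =>
    hdisj 0 (by omega) j h1 h2 (by rw [h]; simp)
  -- -β cannot lie in the first progression, since adding β would return to 0 too early. If it were
  -- a later term η + (i + 1)γ with i ≥ 1, locating -γ would give either a common element of the two
  -- progressions or a zero in the second.
  have key : η + γ = -β := by
    rcases hcov (-β) with ⟨j, hj, h⟩ | ⟨i, h1, h2, h⟩
    · exfalso
      have h' : ((j + 1 : ℕ) : Z) * β = 0 := by push_cast; linear_combination -h
      rcases (Nat.succ_le_of_lt hj).eq_or_lt with e | e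
      · have e' : j + 1 = ℓ := e
        rw [e', hlast] at h'
        exact hzero N (by omega) le_rfl h'
      · have := hinjS (j + 1) e 0 (by omega) (by rw [h']; simp)
        omega
    · obtain ⟨i, rfl⟩ : ∃ i', i = i' + 1 := ⟨i - 1, by omega⟩
      rcases Nat.eq_zero_or_pos i with rfl | hi
      · rw [h]; push_cast; ring
      exfalso
      push_cast at h
      rcases hcov (-γ) with ⟨j, hj, e⟩ | ⟨j, h3, h4, e⟩
      · rcases j with _ | j
        · exact hγ (by push_cast at e; linear_combination -e)
        · push_cast at e
          exact hdisj j (by omega) i hi (by omega) (by linear_combination h - e)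
      · rcases h4.eq_or_lt with rfl | h4
        · obtain ⟨m, rfl⟩ : ∃ m, ℓ = m + 1 := ⟨ℓ - 1, by omega⟩
          push_cast at hlast
          exact hdisj m (by omega) i hi (by omega) (by linear_combination h - e + hlast)
        · exact hzero (j + 1) (by omega) h4 (by push_cast; linear_combination -e)
  -- If γ = (j + 1)β, then jβ = γ - β = η + 2γ is a common element; this is where N ≥ 2 enters.
  rcases hcov γ with ⟨j, hj, e⟩ | ⟨j, h3, h4, e⟩
  · exfalso
    rcases j with _ | j
    · exact hγ (by push_cast at e; linear_combination e)
    · push_cast at e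
      exact hdisj j (by omega) 2 (by omega) hN (by push_cast; linear_combination -e - key)
  · obtain ⟨j, rfl⟩ : ∃ i', j = i' + 1 := ⟨j - 1, by omega⟩
    push_cast at e
    rcases Nat.eq_zero_or_pos j with rfl | hj
    · have hη : η = 0 := by push_cast at e; linear_combination -e
      exact ⟨hη, by linear_combination key - hη⟩
    · exact absurd (by linear_combination -e) (hzero j hj (by omega))

/-- Natural numbers that are distinct modulo `a` and as many as `a` represent all classes. -/
theorem exists_natCast_eq_of_injective {a : ℕ} [NeZero a] {w : ℕ → ℕ}
    (hw : ∀ m < a, ∀ m' < a, (w m : ZMod a) = w m' → m = m') (z : ZMod a) :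
    ∃ m < a, (w m : ZMod a) = z := by
  have hinj : Function.Injective fun m : Fin a => (w m : ZMod a) := fun m m' h =>
    Fin.ext (hw m m.2 m' m'.2 h)
  have hbij := (Fintype.bijective_iff_injective_and_card _).2 ⟨hinj, by simp [ZMod.card]⟩
  obtain ⟨m, hm⟩ := hbij.2 z
  exact ⟨m, m.2, hm⟩

/-! ### The Apéry set and the integer q -/

/-- The semigroups of multiplicity `a = ℓ + N` whose minimal generators are `a`, `b` and
`h + iα + a` for `1 ≤ i < N`, where `h + iα` for `1 ≤ i ≤ N` are gaps and
`ℓb = h + Nα + a`. -/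
structure IsProgressionSemigroup (H : AddSubmonoid ℕ) (a N ℓ h α b : ℕ) : Prop where
  isMultiplicity : IsMultiplicity H a
  eq_add : a = ℓ + N
  two_le_N : 2 ≤ N
  two_le_ℓ : 2 ≤ ℓ
  α_pos : 0 < α
  ℓ_mul_b : ℓ * b = h + N * α + a
  b_mem : b ∈ H
  b_ne : b ≠ a
  c_mem : ∀ i, 1 ≤ i → i < N → h + i * α + a ∈ H
  c_ne_b : ∀ i, 1 ≤ i → i < N → h + i * α + a ≠ b
  c_ne_add : ∀ i, 1 ≤ i → i < N → ∀ u ∈ H, ∀ v ∈ H, u ≠ 0 → v ≠ 0 → h + i * α + a ≠ u + v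
  gap : ∀ i, 1 ≤ i → i ≤ N → h + i * α ∉ H
  closure_eq : AddSubmonoid.closure ({a, b} ∪ {x | ∃ i, 1 ≤ i ∧ i < N ∧ x = h + i * α + a}) = H

namespace IsProgressionSemigroup

/-- The elements of the Apéry set: `0, b, …, ℓb` and `h + iα + a` for `1 ≤ i < N`. -/
def apery (a ℓ h α b m : ℕ) : ℕ := if m ≤ ℓ then m * b else h + (m - ℓ) * α + a

variable {H : AddSubmonoid ℕ} {a N ℓ h α b : ℕ}

theorem apery_of_le {m : ℕ} (hm : m ≤ ℓ) : apery a ℓ h α b m = m * b := if_pos hm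

theorem apery_add {i : ℕ} (hi : 1 ≤ i) : apery a ℓ h α b (ℓ + i) = h + i * α + a := by
  rw [apery, if_neg (by omega), Nat.add_sub_cancel_left]

variable (P : IsProgressionSemigroup H a N ℓ h α b)
include P

theorem a_pos : 0 < a := Nat.pos_of_ne_zero P.isMultiplicity.1.2

theorem a_mem : a ∈ H := P.isMultiplicity.1.1

theorem b_pos : 0 < b := by
  rcases Nat.eq_zero_or_pos b with h0 | h0
  · have := P.ℓ_mul_b
    rw [h0, mul_zero] at this
    have := P.a_pos
    omega
  · exact h0

theorem mul_b_mem (m : ℕ) : m * b ∈ H := by simpa using H.nsmul_mem P.b_mem m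

theorem mul_a_mem (m : ℕ) : m * a ∈ H := by simpa using H.nsmul_mem P.a_mem m

theorem apery_mem {m : ℕ} (hm : m < a) : apery a ℓ h α b m ∈ H := by
  rcases le_or_gt m ℓ with h1 | h1
  · rw [apery_of_le h1]; exact P.mul_b_mem m
  · obtain ⟨i, rfl⟩ := Nat.exists_eq_add_of_lt h1
    rw [add_assoc, apery_add (by omega)]
    exact P.c_mem _ (by omega) (by have := P.eq_add; omega)

/-- If mb - a were in H, adding (ℓ - m)b would put the gap h + Nα = ℓb - a into H. -/
theorem apery_ne_add {m u : ℕ} (hm : m < a) (hu : u ∈ H) : apery a ℓ h α b m ≠ u + a := by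
  intro e
  rcases le_or_gt m ℓ with h1 | h1
  · rw [apery_of_le h1] at e
    refine P.gap N (by have := P.two_le_N; omega) le_rfl ?_
    have h2 : h + N * α = (ℓ - m) * b + u := by
      have h3 := P.ℓ_mul_b
      have h4 : (ℓ - m) * b + m * b = ℓ * b := by rw [← add_mul, Nat.sub_add_cancel h1]
      omega
    rw [h2]
    exact H.add_mem (P.mul_b_mem _) hu
  · obtain ⟨i, rfl⟩ := Nat.exists_eq_add_of_lt h1
    rw [add_assoc, apery_add (by omega)] at e
    refine P.gap (i + 1) (by omega) (by have := P.eq_add; omega) ?_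
    rwa [Nat.add_right_cancel e]

theorem apery_injective {m m' : ℕ} (hm : m < a) (hm' : m' < a)
    (e : apery a ℓ h α b m = apery a ℓ h α b m') : m = m' := by
  have hmix : ∀ i j, i ≤ ℓ → 1 ≤ j → j < N → i * b ≠ h + j * α + a := by
    intro i j _ hj hjN e
    rcases i with _ | _ | i
    · have := P.a_pos; omega
    · exact P.c_ne_b j hj hjN (by omega)
    · refine P.c_ne_add j hj hjN b P.b_mem ((i + 1) * b) (P.mul_b_mem _) P.b_pos.ne'
        (Nat.mul_ne_zero (by omega) P.b_pos.ne') ?_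
      rw [← e]; ring
  have := P.eq_add
  rcases le_or_gt m ℓ with h1 | h1 <;> rcases le_or_gt m' ℓ with h2 | h2
  · rw [apery_of_le h1, apery_of_le h2] at e
    exact Nat.eq_of_mul_eq_mul_right P.b_pos e
  · obtain ⟨i, rfl⟩ := Nat.exists_eq_add_of_lt h2
    rw [apery_of_le h1, add_assoc, apery_add (by omega)] at e
    exact absurd e (hmix _ _ h1 (by omega) (by omega))
  · obtain ⟨i, rfl⟩ := Nat.exists_eq_add_of_lt h1
    rw [apery_of_le h2, add_assoc, apery_add (by omega)] at e
    exact absurd e.symm (hmix _ _ h2 (by omega) (by omega))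
  · obtain ⟨i, rfl⟩ := Nat.exists_eq_add_of_lt h1
    obtain ⟨j, rfl⟩ := Nat.exists_eq_add_of_lt h2
    rw [add_assoc ℓ i, apery_add (by omega), add_assoc ℓ j, apery_add (by omega)] at e
    have : (i + 1) * α = (j + 1) * α := by omega
    have := Nat.eq_of_mul_eq_mul_right P.α_pos this
    omega

theorem apery_unique {m m' j j' : ℕ} (hm : m < a) (hm' : m' < a)
    (e : apery a ℓ h α b m + j * a = apery a ℓ h α b m' + j' * a) : m = m' ∧ j = j' := by
  have hle : ∀ {m m' j j' : ℕ}, m < a → m' < a →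
      apery a ℓ h α b m + j * a = apery a ℓ h α b m' + j' * a → j ≤ j' := by
    intro m m' j j' hm hm' e
    by_contra! hlt
    obtain ⟨i, rfl⟩ := Nat.exists_eq_add_of_lt hlt
    refine P.apery_ne_add hm' (H.add_mem (P.apery_mem hm) (P.mul_a_mem i)) ?_
    have : (j' + i + 1) * a = j' * a + i * a + a := by ring
    omega
  have hj : j = j' := le_antisymm (hle hm hm' e) (hle hm' hm e.symm)
  subst hj
  exact ⟨P.apery_injective hm hm' (Nat.add_right_cancel e), rfl⟩

theorem apery_natCast_injective {m m' : ℕ} (hm : m < a) (hm' : m' < a)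
    (e : (apery a ℓ h α b m : ZMod a) = apery a ℓ h α b m') : m = m' := by
  rw [ZMod.natCast_eq_natCast_iff] at e
  rcases le_total (apery a ℓ h α b m) (apery a ℓ h α b m') with hle | hle
  · obtain ⟨j, hj⟩ := (Nat.modEq_iff_dvd' hle).1 e
    refine (P.apery_unique (j := j) (j' := 0) hm hm' ?_).1
    rw [mul_comm]; omega
  · obtain ⟨j, hj⟩ := (Nat.modEq_iff_dvd' hle).1 e.symm
    refine (P.apery_unique (j := 0) (j' := j) hm hm' ?_).1
    rw [mul_comm j]; omega

theorem exists_apery_natCast_eq (z : ZMod a) : ∃ m < a, (apery a ℓ h α b m : ZMod a) = z := by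
  have : NeZero a := ⟨P.a_pos.ne'⟩
  exact exists_natCast_eq_of_injective (fun m hm m' hm' e => P.apery_natCast_injective hm hm' e) z

theorem exists_eq_apery_add {s : ℕ} (hs : s ∈ H) :
    ∃ m < a, ∃ j, s = apery a ℓ h α b m + j * a := by
  obtain ⟨m, hm, e⟩ := P.exists_apery_natCast_eq (s : ZMod a)
  rw [ZMod.natCast_eq_natCast_iff] at e
  rcases le_total (apery a ℓ h α b m) s with hle | hle
  · obtain ⟨j, hj⟩ := (Nat.modEq_iff_dvd' hle).1 e
    exact ⟨m, hm, j, by rw [mul_comm]; omega⟩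
  · obtain ⟨j, hj⟩ := (Nat.modEq_iff_dvd' hle).1 e.symm
    rcases j with _ | j
    · exact ⟨m, hm, 0, by omega⟩
    · exfalso
      refine P.apery_ne_add hm (H.add_mem hs (P.mul_a_mem j)) ?_
      have : a * (j + 1) = j * a + a := by ring
      omega

/-- The residue of ℓb is that of h + Nα, so it is counted as the last term of the second
progression. -/
theorem dvd_h_and_dvd_b_add_α : a ∣ h ∧ a ∣ b + α := by
  have ha0 : ((a : ℕ) : ZMod a) = 0 := ZMod.natCast_self a
  have hN := P.two_le_N
  have hℓ := P.two_le_ℓ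
  have haN := P.eq_add
  have hlast : ((ℓ : ℕ) : ZMod a) * b = h + N * α := by
    have := congrArg (Nat.cast : ℕ → ZMod a) P.ℓ_mul_b
    push_cast at this
    rw [this, ha0, add_zero]
  have hcS : ∀ i ≤ ℓ, ((apery a ℓ h α b i : ℕ) : ZMod a) = i * b := fun i hi => by
    rw [apery_of_le hi]; push_cast; rfl
  have hcT : ∀ i, 1 ≤ i → ((apery a ℓ h α b (ℓ + i) : ℕ) : ZMod a) = h + i * α := fun i hi => by
    rw [apery_add hi]; push_cast; rw [ha0, add_zero]
  have hne : ∀ i < ℓ, ∀ j, 1 ≤ j → j ≤ N → (i : ZMod a) * b ≠ h + j * α := by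
    intro i hi j hj1 hj2 e
    rcases hj2.eq_or_lt with rfl | hj2
    · rw [← hlast, ← hcS i hi.le, ← hcS ℓ le_rfl] at e
      have := P.apery_natCast_injective (by omega) (by omega) e
      omega
    · rw [← hcS i hi.le, ← hcT j hj1] at e
      have := P.apery_natCast_injective (by omega) (by omega) e
      omega
  have key := eq_neg_of_partition_progressions (β := (b : ZMod a)) (γ := α) (η := h) hℓ hN ?_ hne
    ?_ ?_ hlast
  · refine ⟨(ZMod.natCast_eq_zero_iff _ _).1 key.1, (ZMod.natCast_eq_zero_iff _ _).1 ?_⟩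
    push_cast
    rw [key.2]; ring
  · intro z
    obtain ⟨m, hm, rfl⟩ := P.exists_apery_natCast_eq z
    rcases lt_trichotomy m ℓ with h1 | rfl | h1
    · exact Or.inl ⟨m, h1, hcS m h1.le⟩
    · exact Or.inr ⟨N, by omega, le_rfl, (hcS m le_rfl).trans hlast⟩
    · obtain ⟨i, rfl⟩ := Nat.exists_eq_add_of_lt h1
      exact Or.inr ⟨i + 1, by omega, by omega, hcT (i + 1) (by omega)⟩
  · intro i hi j hj e
    rw [← hcS i hi.le, ← hcS j hj.le] at e
    exact P.apery_natCast_injective (by omega) (by omega) e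
  · intro h0
    have e : ((apery a ℓ h α b (ℓ + 1) : ℕ) : ZMod a) = (apery a ℓ h α b ℓ : ℕ) := by
      rw [hcT 1 le_rfl, hcS ℓ le_rfl, hlast, h0]; ring
    have := P.apery_natCast_injective (by omega) (by omega) e
    omega

/-- Adding ℓα to ℓb = h + Nα + a and using ℓ + N = a makes every term divisible by a. -/
theorem exists_quotients : ∃ h₁ q : ℕ, h = h₁ * a ∧ b + α = q * a ∧ ℓ * q = h₁ + 1 + α := by
  obtain ⟨⟨h₁, e₁⟩, ⟨q, e₂⟩⟩ := P.dvd_h_and_dvd_b_add_α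
  refine ⟨h₁, q, by rw [e₁]; ring, by rw [e₂]; ring, ?_⟩
  refine Nat.eq_of_mul_eq_mul_left P.a_pos ?_
  have h1 := P.ℓ_mul_b
  have h2 := P.eq_add
  calc a * (ℓ * q) = ℓ * (a * q) := by ring
    _ = ℓ * b + ℓ * α := by rw [← e₂]; ring
    _ = h + (ℓ + N) * α + a := by rw [h1]; ring
    _ = a * (h₁ + 1 + α) := by rw [← h2, e₁]; ring

theorem two_le_of_b_add_α_eq {q : ℕ} (hq : b + α = q * a) : 2 ≤ q := by
  have h1 : a ≤ b := P.isMultiplicity.2 ⟨P.b_mem, P.b_pos.ne'⟩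
  have h2 := P.b_ne
  have h3 := P.α_pos
  by_contra! hlt
  have : q * a ≤ 1 * a := Nat.mul_le_mul_right a (by omega)
  omega

theorem not_isCohenMacaulay (k : Type*) [Field k] {q : ℕ} (hq : b + α = q * a) (hqℓ : q < ℓ) :
    ¬ IsCohenMacaulay (TangentCone k H) := by
  classical
  obtain ⟨i, rfl⟩ : ∃ i, N = i + 2 := ⟨N - 2, by have := P.two_le_N; omega⟩
  have ha0 := P.isMultiplicity.1.2
  have hcH := P.c_mem (i + 1) (by omega) (by omega)
  have hex : ∃ j, h + (i + 1) * α + a + j * a ∈ foldSum H (j + 2) := by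
    refine ⟨q, ?_⟩
    have h1 : h + (i + 1) * α + a + q * a = 0 + (ℓ + 1) * b := by
      have := P.ℓ_mul_b
      calc h + (i + 1) * α + a + q * a = h + (i + 1) * α + a + (b + α) := by rw [hq]
        _ = h + (i + 2) * α + a + b := by ring
        _ = 0 + (ℓ + 1) * b := by rw [← this]; ring
    rw [h1]
    have h2 := add_mul_mem_foldSum (r := 0) (s := 0) H.zero_mem P.b_mem P.b_pos.ne' (ℓ + 1)
    exact foldSum_antitone H (by omega) h2
  -- At the least such j the order jumps. It is not 0, because c_{N-1} is a minimal generator; so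
  -- its predecessor has the order suggested by its expression, and adding a raises that order by at
  -- least two.
  have hmin := fun j => Nat.find_min (m := j) hex
  have hspec := Nat.find_spec hex
  rcases hj : Nat.find hex with _ | j
  · rw [hj, zero_mul, add_zero] at hspec
    obtain ⟨_, ⟨u, hu, g, hg, hg0, rfl⟩, g', hg', hg0', e⟩ := hspec
    exact absurd e <| P.c_ne_add (i + 1) (by omega) (by omega) (u + g)
      (H.add_mem hu hg) g' hg' (by omega) hg0'
  · rw [hj] at hspec
    have hcj := add_mul_mem_foldSum (mem_foldSum_one hcH (by omega)) P.a_mem ha0 j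
    refine not_isCohenMacaulay_tangentCone P.isMultiplicity hcj ?_ ?_
    · rw [show 1 + j + 1 = j + 2 by ring]
      exact hmin j (by omega)
    · rw [show 1 + j + 2 = j + 1 + 2 by ring]
      convert hspec using 1
      ring

/-! ### The order function when q ≥ ℓ -/

open Classical in
/-- The order of an element of `H`: that of `mb + ja` with `m ≤ ℓ` is `m + j`, and that of
`(h + iα + a) + ja` is `1 + j`. -/
noncomputable def order (a ℓ h α b s : ℕ) : ℕ :=
  if hs : ∃ p : ℕ × ℕ, p.1 < a ∧ s = apery a ℓ h α b p.1 + p.2 * a then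
    (if hs.choose.1 ≤ ℓ then hs.choose.1 else 1) + hs.choose.2
  -- The value outside `H` is immaterial: `mem_foldSum_iff` requires membership in `H` separately.
  else 0

theorem order_apery_add {m : ℕ} (hm : m < a) (j : ℕ) :
    order a ℓ h α b (apery a ℓ h α b m + j * a) = (if m ≤ ℓ then m else 1) + j := by
  have hs : ∃ p : ℕ × ℕ, p.1 < a ∧
      apery a ℓ h α b m + j * a = apery a ℓ h α b p.1 + p.2 * a := ⟨(m, j), hm, rfl⟩
  obtain ⟨h1, h2⟩ := P.apery_unique hm hs.choose_spec.1 hs.choose_spec.2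
  rw [order, dif_pos hs, ← h1, ← h2]

theorem order_mul_b {m : ℕ} (hm : m ≤ ℓ) (j : ℕ) :
    order a ℓ h α b (m * b + j * a) = m + j := by
  have := P.order_apery_add (m := m) (by have := P.eq_add; have := P.two_le_N; omega) j
  rwa [apery_of_le hm, if_pos hm] at this

theorem order_c {i : ℕ} (h1 : 1 ≤ i) (h2 : i < N) (j : ℕ) :
    order a ℓ h α b (h + i * α + a + j * a) = 1 + j := by
  have := P.order_apery_add (m := ℓ + i) (by have := P.eq_add; omega) j
  rwa [apery_add h1, if_neg (by omega)] at this

theorem cases_mem {s : ℕ} (hs : s ∈ H) : (∃ m ≤ ℓ, ∃ j, s = m * b + j * a) ∨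
    ∃ i, 1 ≤ i ∧ i < N ∧ ∃ j, s = h + i * α + a + j * a := by
  obtain ⟨m, hm, j, rfl⟩ := P.exists_eq_apery_add hs
  rcases le_or_gt m ℓ with h1 | h1
  · exact Or.inl ⟨m, h1, j, by rw [apery_of_le h1]⟩
  · obtain ⟨i, rfl⟩ := Nat.exists_eq_add_of_lt h1
    refine Or.inr ⟨i + 1, by omega, by have := P.eq_add; omega, j, ?_⟩
    rw [add_assoc ℓ, apery_add (by omega)]

theorem order_add_a {s : ℕ} (hs : s ∈ H) :
    order a ℓ h α b (s + a) = order a ℓ h α b s + 1 := by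
  obtain ⟨m, hm, j, rfl⟩ := P.exists_eq_apery_add hs
  rw [show apery a ℓ h α b m + j * a + a = apery a ℓ h α b m + (j + 1) * a by ring,
    P.order_apery_add hm, P.order_apery_add hm]
  ring

theorem order_add_b {q : ℕ} (hq : b + α = q * a) (hqℓ : ℓ ≤ q) {s : ℕ} (hs : s ∈ H) :
    order a ℓ h α b s + 1 ≤ order a ℓ h α b (s + b) := by
  have hN := P.two_le_N
  have hℓ := P.two_le_ℓ
  rcases P.cases_mem hs with ⟨m, hm, j, rfl⟩ | ⟨i, hi1, hi2, j, rfl⟩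
  · rw [P.order_mul_b hm]
    rcases hm.eq_or_lt with rfl | hm
    · obtain ⟨i, rfl⟩ : ∃ i, N = i + 2 := ⟨N - 2, by omega⟩
      -- The one place where q ≥ ℓ is sharp: ℓ + 1 copies of b become c_{N-1} and q copies of a.
      have e : m * b + j * a + b = h + (i + 1) * α + a + (q + j) * a := by
        rw [P.ℓ_mul_b, add_mul q j, ← hq]; ring
      rw [e, P.order_c (by omega) (by omega)]
      omega
    · rw [show m * b + j * a + b = (m + 1) * b + j * a by ring, P.order_mul_b hm]
      omega
  · rw [P.order_c hi1 hi2]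
    obtain ⟨i, rfl⟩ : ∃ i', i = i' + 1 := ⟨i - 1, by omega⟩
    rcases Nat.eq_zero_or_pos i with rfl | hi
    · obtain ⟨h₁, e₁⟩ := P.dvd_h_and_dvd_b_add_α.1
      have e : h + (0 + 1) * α + a + j * a + b = 0 * b + (h₁ + 1 + q + j) * a := by
        have : (h₁ + 1 + q + j) * a = a * h₁ + a + q * a + j * a := by ring
        rw [this, ← e₁, ← hq]; ring
      rw [e, P.order_mul_b (by omega)]
      omega
    · have e : h + (i + 1) * α + a + j * a + b = h + i * α + a + (q + j) * a := by
        rw [add_mul q j, ← hq]; ring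
      rw [e, P.order_c hi (by omega)]
      omega

theorem order_add_c {q : ℕ} (hq : b + α = q * a) (hqℓ : ℓ ≤ q) {s : ℕ} (hs : s ∈ H) {i : ℕ}
    (hi1 : 1 ≤ i) (hi2 : i < N) :
    order a ℓ h α b s + 1 ≤ order a ℓ h α b (s + (h + i * α + a)) := by
  have hN := P.two_le_N
  have hℓ := P.two_le_ℓ
  obtain ⟨h₁, e₁⟩ := P.dvd_h_and_dvd_b_add_α.1
  -- Exchange rule: each b lowers the index of c_i by one and contributes q copies of a.
  have hmul : ∀ m, m * b + m * α = m * q * a := fun m => by rw [← mul_add, hq, mul_assoc]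
  have hle : ∀ m, m ≤ m * q := fun m => Nat.le_mul_of_pos_right m (by omega)
  have hmixed : ∀ m ≤ ℓ, ∀ j i, 1 ≤ i → i < N →
      m + j + 1 ≤ order a ℓ h α b (m * b + j * a + (h + i * α + a)) := by
    intro m hm j i hi1 hi2
    rcases lt_or_ge m i with hmi | hmi
    · obtain ⟨u, rfl⟩ := Nat.exists_eq_add_of_lt hmi
      have e : m * b + j * a + (h + (m + u + 1) * α + a) =
          h + (u + 1) * α + a + (m * q + j) * a := by
        rw [add_mul (m * q) j, ← hmul]; ring
      rw [e, P.order_c (by omega) (by omega)]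
      have := hle m
      omega
    · obtain ⟨u, rfl⟩ := Nat.exists_eq_add_of_le hmi
      have e : (i + u) * b + j * a + (h + i * α + a) =
          u * b + (i * q + h₁ + 1 + j) * a := by
        have : (i * q + h₁ + 1 + j) * a = i * q * a + a * h₁ + a + j * a := by ring
        rw [this, ← hmul, ← e₁]; ring
      rw [e, P.order_mul_b (by omega)]
      have := hle i
      omega
  rcases P.cases_mem hs with ⟨m, hm, j, rfl⟩ | ⟨i', hi1', hi2', j, rfl⟩
  · rw [P.order_mul_b hm]
    exact hmixed m hm j i hi1 hi2
  · rw [P.order_c hi1' hi2']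
    -- Indices add: c_{i'} + c_i is c_{i'+i} plus h₁ + 1 copies of a. When i' + i ≥ N, c_N = ℓb is
    -- split off and the case of mb + c_v applies.
    have hsum : ∀ u v, u + v = i' + i → h + i' * α + a + j * a + (h + i * α + a) =
        h + u * α + a + v * α + (h₁ + 1 + j) * a := by
      intro u v huv
      have h1 : (h₁ + 1 + j) * a = a * h₁ + a + j * a := by ring
      have h2 : u * α + v * α = i' * α + i * α := by rw [← add_mul, huv, add_mul]
      rw [h1, ← e₁]; omega
    rcases lt_or_ge (i' + i) N with hlt | hge
    · rw [hsum (i' + i) 0 rfl, zero_mul, add_zero, P.order_c (by omega) hlt]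
      omega
    · obtain ⟨v, hv⟩ := Nat.exists_eq_add_of_le hge
      rw [hsum N v hv.symm, ← P.ℓ_mul_b]
      rcases Nat.eq_zero_or_pos v with rfl | hv0
      · rw [zero_mul, add_zero, P.order_mul_b le_rfl]
        omega
      · have e : h + i' * α + a + j * a + (h + i * α + a) =
            ℓ * b + j * a + (h + v * α + a) := by
          rw [hsum N v hv.symm, ← P.ℓ_mul_b]
          have : (h₁ + 1 + j) * a = a * h₁ + a + j * a := by ring
          rw [this, ← e₁]; ring
        rw [P.ℓ_mul_b, ← hsum N v hv.symm, e]
        have := hmixed ℓ le_rfl j v hv0 (by omega)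
        omega

theorem order_add {q : ℕ} (hq : b + α = q * a) (hqℓ : ℓ ≤ q) {g : ℕ} (hg : g ∈ H) :
    ∀ s ∈ H, order a ℓ h α b s ≤ order a ℓ h α b (s + g) ∧
      (g ≠ 0 → order a ℓ h α b s + 1 ≤ order a ℓ h α b (s + g)) := by
  rw [← P.closure_eq] at hg
  induction hg using AddSubmonoid.closure_induction with
  | mem g hg =>
    intro s hs
    have : order a ℓ h α b s + 1 ≤ order a ℓ h α b (s + g) := by
      rcases hg with (rfl | rfl) | ⟨i, h1, h2, rfl⟩
      · exact (P.order_add_a hs).ge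
      · exact P.order_add_b hq hqℓ hs
      · exact P.order_add_c hq hqℓ hs h1 h2
    exact ⟨by omega, fun _ => this⟩
  | zero => exact fun s _ => ⟨le_rfl, fun h0 => absurd rfl h0⟩
  | add x y hx hy ihx ihy =>
    intro s hs
    rw [P.closure_eq] at hx
    have h1 := ihx s hs
    have h2 := ihy (s + x) (H.add_mem hs hx)
    rw [← add_assoc]
    refine ⟨h1.1.trans h2.1, fun h0 => ?_⟩
    rcases Nat.eq_zero_or_pos x with hx0 | hx0
    · have := h2.2 (by omega)
      omega
    · have := h1.2 hx0.ne'
      omega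

/-- Superadditivity along generators bounds the length of every expression by `order`; the normal
form attains this bound. -/
theorem mem_foldSum_iff {q : ℕ} (hq : b + α = q * a) (hqℓ : ℓ ≤ q) (r s : ℕ) :
    s ∈ foldSum H r ↔ s ∈ H ∧ r ≤ order a ℓ h α b s := by
  constructor
  · intro hs
    refine ⟨foldSum_subset H r hs, ?_⟩
    induction r generalizing s with
    | zero => exact Nat.zero_le _
    | succ r ih =>
      obtain ⟨u, hu, g, hg, hg0, rfl⟩ := hs
      have := ih u hu
      have := (P.order_add hq hqℓ hg u (foldSum_subset H r hu)).2 hg0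
      omega
  · rintro ⟨hs, hr⟩
    refine foldSum_antitone H hr ?_
    rcases P.cases_mem hs with ⟨m, hm, j, rfl⟩ | ⟨i, hi1, hi2, j, rfl⟩
    · rw [P.order_mul_b hm]
      have h1 := add_mul_mem_foldSum (r := 0) (s := 0) H.zero_mem P.b_mem P.b_pos.ne' m
      have h2 := add_mul_mem_foldSum h1 P.a_mem P.a_pos.ne' j
      rwa [zero_add, zero_add] at h2
    · rw [P.order_c hi1 hi2]
      exact add_mul_mem_foldSum (mem_foldSum_one (P.c_mem i hi1 hi2)
        (by have := P.a_pos; omega)) P.a_mem P.a_pos.ne' j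

theorem isCohenMacaulay_iff (k : Type*) [Field k] {q : ℕ} (hq : b + α = q * a) :
    IsCohenMacaulay (TangentCone k H) ↔ ℓ ≤ q := by
  refine ⟨fun hCM => ?_, fun hqℓ => ?_⟩
  · by_contra! hlt
    exact P.not_isCohenMacaulay k hq hlt hCM
  · refine isCohenMacaulay_tangentCone P.a_mem P.a_pos.ne' (P.mem_foldSum_iff hq hqℓ)
      (fun s hs => P.order_add_a hs) ((Set.finite_Iio a).image (apery a ℓ h α b)) ?_ ?_
    · rintro _ ⟨m, hm, rfl⟩
      exact P.apery_mem hm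
    · intro s hs
      obtain ⟨m, hm, j, e⟩ := P.exists_eq_apery_add hs
      exact ⟨_, ⟨m, hm, rfl⟩, j, e⟩

end IsProgressionSemigroup
end NumSemigroup

theorem theorem4p2 {k : Type*} [Field k] (H : AddSubmonoid ℕ) (hH : NumSemigroup.IsNumerical H)
    (a n ℓ h α b : ℕ) (A : Set ℕ) (h₁ : ℚ)
    -- `H` has multiplicity `a`, embedding dimension `n ≥ 3`, and `ℓ = a - n + 1 ≥ 2`
    (ha : NumSemigroup.IsMultiplicity H a)
    (hA : NumSemigroup.IsMinimalGenerators H A) (hAn : A.ncard = n) (hn : 3 ≤ n)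
    (hℓ : a = ℓ + n - 1) (hℓ2 : 2 ≤ ℓ)
    (hstr : IsStretchedArtinianLocal
      (NumSemigroup.semigroupRing k H ⧸ Ideal.span {NumSemigroup.tpow k ⟨a, ha.1.1⟩}))
    -- `PF(H) = {h + α, h + 2α, …, h + (n - 1)α}`
    (hα : 0 < α)
    (hPF : NumSemigroup.pseudoFrobenius H =
      (fun i : ℕ => (h : ℤ) + i * α) '' Set.Icc 1 (n - 1))
    -- the case `j = n - 1`: the minimal generators are `a`, `b = (h + (n - 1)α + a) / ℓ` and
    -- `h + iα + a` for `1 ≤ i ≤ n - 2`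
    (hb : ℓ * b = h + (n - 1) * α + a)
    (hj : A = {a, b} ∪ (fun i : ℕ => h + i * α + a) '' Set.Icc 1 (n - 2))
    (hh₁ : h₁ = (h : ℚ) / a) :
    (IsCohenMacaulay (NumSemigroup.TangentCone k H) ↔ (ℓ : ℚ) ≤ (h₁ + 1 + α) / ℓ) ∧
    ((ℓ : ℚ) ^ 2 - ℓ - α ≤ h₁ → IsCohenMacaulay (NumSemigroup.TangentCone k H)) ∧
    (ℓ = 2 → IsCohenMacaulay (NumSemigroup.TangentCone k H)) := by
  have hncard : ((fun i : ℕ => h + i * α + a) '' Set.Icc 1 (n - 2)).ncard ≤ n - 2 := by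
    refine (Set.ncard_image_le (Set.finite_Icc _ _)).trans ?_
    rw [Set.ncard_eq_toFinset_card', Set.toFinset_Icc, Nat.card_Icc]
    omega
  -- If b were equal to a or to some c_i, at most n - 1 generators would remain.
  have hbound : ∀ c : ℕ, A ⊆ insert c ((fun i : ℕ => h + i * α + a) '' Set.Icc 1 (n - 2)) →
      False := by
    intro c hc
    have h1 := Set.ncard_le_ncard hc (((Set.finite_Icc _ _).image _).insert _)
    have h2 := Set.ncard_insert_le c ((fun i : ℕ => h + i * α + a) '' Set.Icc 1 (n - 2))
    omega
  have hcl : AddSubmonoid.closure A = H := hA.1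
  have hAH : A ⊆ H := fun x hx => hcl ▸ AddSubmonoid.subset_closure hx
  have hcA : ∀ i, 1 ≤ i → i < n - 1 → h + i * α + a ∈ A := fun i h1 h2 =>
    hj ▸ Or.inr ⟨i, ⟨h1, by omega⟩, rfl⟩
  have P : NumSemigroup.IsProgressionSemigroup H a (n - 1) ℓ h α b := by
    refine ⟨ha, by omega, by omega, hℓ2, hα, hb, hAH (hj ▸ Or.inl (Or.inr rfl)), ?_,
      fun i h1 h2 => hAH (hcA i h1 h2), ?_,
      fun i h1 h2 u hu v hv hu0 hv0 => hA.ne_add (hcA i h1 h2) hu hv hu0 hv0, ?_, ?_⟩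
    · rintro rfl
      refine hbound b ?_
      rw [hj]
      rintro x ((rfl | rfl) | hx)
      exacts [Or.inl rfl, Or.inl rfl, Or.inr hx]
    · intro i h1 h2 e
      refine hbound a ?_
      rw [hj]
      rintro x ((rfl | rfl) | hx)
      exacts [Or.inl rfl, Or.inr ⟨i, ⟨h1, by omega⟩, e⟩, Or.inr hx]
    · intro i h1 h2 hmem
      have h3 : ((h : ℤ) + i * α) ∈ NumSemigroup.pseudoFrobenius H :=
        hPF ▸ ⟨i, ⟨h1, h2⟩, rfl⟩
      exact h3.1 ⟨h + i * α, hmem, by push_cast; rfl⟩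
    · rw [← hcl, hj]
      congr 2
      ext x
      constructor
      · rintro ⟨i, h1, h2, rfl⟩
        exact ⟨i, ⟨h1, by omega⟩, rfl⟩
      · rintro ⟨i, ⟨h1, h2⟩, rfl⟩
        exact ⟨i, h1, by omega, rfl⟩
  obtain ⟨m, q, hm, hq, hmq⟩ := P.exists_quotients
  have hCM := P.isCohenMacaulay_iff k hq
  have ha0 : (a : ℚ) ≠ 0 := Nat.cast_ne_zero.2 ha.1.2
  have hℓ0 : (ℓ : ℚ) ≠ 0 := Nat.cast_ne_zero.2 (by omega)
  have hh : h₁ = m := by rw [hh₁, hm]; push_cast; field_simp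
  have hmq' : (ℓ : ℚ) * q = m + 1 + α := by exact_mod_cast hmq
  have hquot : (h₁ + 1 + α) / ℓ = q := by rw [hh, ← hmq']; field_simp
  refine ⟨?_, fun hle => hCM.2 ?_, fun h2 => hCM.2 ?_⟩
  · rw [hCM, hquot, Nat.cast_le]
  · rw [hh] at hle
    -- The bound on h₁ gives ℓq = h₁ + 1 + α ≥ ℓ² - ℓ + 1, and integrality of q turns q > ℓ - 1 into
    -- q ≥ ℓ.
    have h1 : (ℓ : ℚ) * ℓ < ℓ * (q + 1) := by nlinarith
    have h2 : (ℓ : ℚ) < q + 1 := lt_of_mul_lt_mul_left h1 (Nat.cast_nonneg ℓ)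
    have h3 : ℓ < q + 1 := by exact_mod_cast h2
    omega
  · rw [h2]
    exact P.two_le_of_b_add_α_eq hq
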